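/- Let $\alpha>0$ and let $C=\begin{pmatrix}c_1&c_{12}\\c_{12}&c_2\end{pmatrix}$ be a real symmetric positive definite matrix. A random vector $(G_1,G_2)$ has the bivariate gamma distribution (of Krishnamoorthy and Parthasarathy) with degree of freedom $2\alpha$ and covariance matrix $C$ if $$\mathbb E\big[e^{i(t_1G_1+t_2G_2)}\big]=\det\big(I_2-iC\,\mathrm{diag}(t_1,t_2)\big)^{-\alpha}\qquad(t_1,t_2\ge 0),$$ with the principal branch of the power. For $a>-1/2$, $b>0$, $c>1$, a random variable has the McKay Type I distribution with parameters $(a,b,c)$ if it has a probability density supported on $(0,\infty)$ and proportional there to $x^{a}e^{-xc/b}I_a(x/b)$, where $I_a$ is the modified Bessel function of the first kind of order $a$. If $C$ is not a multiple of the identity matrix, put $$a=\alpha-\tfrac12,\qquad b=\frac{2(c_1c_2-c_{12}^2)}{\sqrt{(c_1+c_2)^2-4(c_1c_2-c_{12}^2)}},\qquad c=\frac{c_1+c_2}{\sqrt{(c_1+c_2)^2-4(c_1c_2-c_{12}^2)}}.\qquad(*)$$ (1) If $(G_1,G_2)$ has the bivariate gamma distribution with degree of freedom $2\alpha$ and covariance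 matrix $C$, and $C$ is not a multiple of the identity, then $G_1+G_2$ has the McKay Type I distribution with the parameters $(a,b,c)$ of $(*)$ (in particular $a>-1/2$, $b>0$, $c>1$). (2) Conversely, let $F$ be a McKay Type I random variable with parameters $(a,b,c)$. Then $F$ has the same law as $G_1+G_2$ for every bivariate gamma vector $(G_1,G_2)$ whose parameters $\alpha$, $C$ satisfy $(*)$, and at least one such vector exists. -/

import Mathlib

open MeasureTheory

/-- The modified Bessel function of the first kind of order `ν`, for `x > 0`:
`I_ν(x) = ∑ₘ (x / 2) ^ (2 m + ν) / (m! Γ(m + ν + 1))`. -/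
noncomputable def besselI (ν x : ℝ) : ℝ :=
  ∑' m : ℕ, (x / 2) ^ (2 * (m : ℝ) + ν) / ((m.factorial : ℝ) * Real.Gamma ((m : ℝ) + ν + 1))

/-- The unnormalised density `x ^ a * exp (-x c / b) * I_a (x / b)`, for `x > 0`. -/
noncomputable def mcKayFun (a b c x : ℝ) : ℝ :=
  x ^ a * Real.exp (-(x * c / b)) * besselI a (x / b)

/-- `μ` is the type I McKay distribution with parameters `a > -1/2`, `b > 0`, `c > 1`: it is a
probability measure, carried by the positive half-line, whose density there is proportional
to `mcKayFun a b c`. -/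
structure IsMcKayTypeI (a b c : ℝ) (μ : Measure ℝ) : Prop where
  neg_half_lt : -(1 / 2) < a
  b_pos : 0 < b
  one_lt : 1 < c
  isProbabilityMeasure : IsProbabilityMeasure μ
  density : ∃ k : ℝ, 0 < k ∧
    μ = (volume.restrict (Set.Ioi 0)).withDensity
      (fun x => ENNReal.ofReal (k * mcKayFun a b c x))

/-- The determinant `|I - i C T|` with `T = diag(t₁, t₂)`. -/
noncomputable def gammaDet (C : Matrix (Fin 2) (Fin 2) ℝ) (t : EuclideanSpace ℝ (Fin 2)) : ℂ :=
  (1 - Complex.I •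
    (C.map Complex.ofReal * Matrix.diagonal (fun j => (t j : ℂ)))).det

/-- In dimension two `|I - i C T|` never meets the cut `(-∞, 0]`, so that the principal branch of
`z ↦ z ^ (-α)` is the branch that is continuous in `t` and equal to `1` at `t = 0`. -/
theorem gammaDet_mem_slitPlane {C : Matrix (Fin 2) (Fin 2) ℝ} (hC : C.PosDef)
    (t : EuclideanSpace ℝ (Fin 2)) : gammaDet C t ∈ Complex.slitPlane := by
  have h0 : 0 < C 0 0 := hC.diag_pos
  have h1 : 0 < C 1 1 := hC.diag_pos
  have hd : 0 < C.det := hC.det_pos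
  rw [Matrix.det_fin_two] at hd
  have key : gammaDet C t = ((1 - (C 0 0 * C 1 1 - C 0 1 * C 1 0) * (t 0 * t 1) : ℝ) : ℂ)
      + ((-(C 0 0 * t 0 + C 1 1 * t 1) : ℝ) : ℂ) * Complex.I := by
    simp only [gammaDet, Matrix.det_fin_two, Matrix.sub_apply, Matrix.smul_apply,
      Matrix.mul_diagonal, Matrix.map_apply, smul_eq_mul, Matrix.one_apply]
    push_cast
    simp
    ring_nf
    simp
    ring
  rw [Complex.mem_slitPlane_iff, key]
  by_cases h : C 0 0 * t 0 + C 1 1 * t 1 = 0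
  · left
    have e : t 1 = -(C 0 0 * t 0) / C 1 1 := by
      field_simp
      linarith
    have hp : t 0 * t 1 ≤ 0 := by
      rw [e]
      have : 0 ≤ C 0 0 / C 1 1 * t 0 ^ 2 := by positivity
      calc t 0 * (-(C 0 0 * t 0) / C 1 1) = -(C 0 0 / C 1 1 * t 0 ^ 2) := by ring
        _ ≤ 0 := by linarith
    simp only [Complex.add_re, Complex.ofReal_re, Complex.re_ofReal_mul, Complex.I_re, mul_zero,
      add_zero]
    nlinarith
  · right
    simpa using fun h' => h (by linarith)

/-- `μ` is the bivariate gamma distribution (in the sense of Krishnamoorthy and Parthasarathy) with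
degree of freedom `2 α` and covariance matrix `C`: its characteristic function is
`|I - i C T| ^ (-α)`, where `T = diag(t₁, t₂)` and `t₁, t₂ ≥ 0`. -/
structure IsBivariateGamma (α : ℝ) (C : Matrix (Fin 2) (Fin 2) ℝ)
    (μ : Measure (EuclideanSpace ℝ (Fin 2))) : Prop where
  α_pos : 0 < α
  posDef : C.PosDef
  isProbabilityMeasure : IsProbabilityMeasure μ
  charFun_eq : ∀ t : EuclideanSpace ℝ (Fin 2), (∀ j, 0 ≤ t j) →
    charFun μ t = gammaDet C t ^ (-(α : ℂ))

/-- The parameter `b` attached to the matrix with entries `c₁, c₁₂, c₁₂, c₂`. -/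
noncomputable def mcKayB (c₁ c₂ c₁₂ : ℝ) : ℝ :=
  2 * ((c₁ * c₂ - c₁₂ ^ 2) / √((c₁ + c₂) ^ 2 - 4 * (c₁ * c₂ - c₁₂ ^ 2)))

/-- The parameter `c` attached to the matrix with entries `c₁, c₁₂, c₁₂, c₂`. -/
noncomputable def mcKayC (c₁ c₂ c₁₂ : ℝ) : ℝ :=
  (c₁ + c₂) / √((c₁ + c₂) ^ 2 - 4 * (c₁ * c₂ - c₁₂ ^ 2))

/-!
The law of the sum of the two components and the McKay law are compared through their characteristic
functions, which on the line need only be known on `[0, ∞)`.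

On the diagonal `t₁ = t₂ = t` the bivariate gamma characteristic function is
`(1 - i t tr C - t ^ 2 det C) ^ (-α)`. For the McKay density, put `s = c / b - i t` and
`α = a + 1 / 2`. Integrating the Bessel series term by term (Euler's integral with the complex rate
`s`, `integral_rpow_mul_cexp_neg_mul_Ioi`) and applying Legendre's duplication formula
(`mcKayCoeff_mul_Gamma`) turns the Fourier integral into a multiple of `s ^ (-2 α)` times the
binomial series of `(1 - (b s) ^ (-2)) ^ (-α)`, that is, into a multiple of
`(s ^ 2 - b ^ (-2)) ^ (-α)` (`integral_mcKayFun_mul_cexp`). The branches of the powers match because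
`s ± 1 / b` lie in the right half-plane. Up to a positive factor `s ^ 2 - b ^ (-2)` is
`1 - i t (2 b c / (c ^ 2 - 1)) - t ^ 2 b ^ 2 / (c ^ 2 - 1)`, and the relations between `C` and
`(b, c)` say that the two coefficients are the trace and the determinant of `C`
(`mcKayDet_mcKayB_mcKayC`). Hence any McKay law and any bivariate gamma law with related parameters
match (`IsMcKayTypeI.eq_map_of_isBivariateGamma`).

McKay laws exist for all admissible parameters by normalising the density, which gives the first
part. For the existence claim in the second, the diagonal matrix with the eigenvalues `b / (c - 1)`
and `b / (c + 1)` has parameters `b` and `c`, and two independent gamma variables form a bivariate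
gamma vector with that matrix.
-/

/-! ### Principal powers on the right half-plane -/

/-- The arguments of two numbers in the right half-plane add up without leaving `(-π, π)`, so that
principal powers are multiplicative there. -/
lemma Complex.mul_cpow_of_re_pos {z w : ℂ} (hz : 0 < z.re) (hw : 0 < w.re) (r : ℂ) :
    (z * w) ^ r = z ^ r * w ^ r := by
  have hz0 : z ≠ 0 := fun h => by simp [h] at hz
  have hw0 : w ≠ 0 := fun h => by simp [h] at hw
  have h1 := abs_lt.1 (abs_arg_lt_pi_div_two_iff.2 (Or.inl hz))
  have h2 := abs_lt.1 (abs_arg_lt_pi_div_two_iff.2 (Or.inl hw))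
  rw [cpow_def_of_ne_zero (mul_ne_zero hz0 hw0), cpow_def_of_ne_zero hz0, cpow_def_of_ne_zero hw0,
    log_mul hz0 hw0 ⟨by linarith [h1.1, h2.1], by linarith [h1.2, h2.2]⟩, add_mul, exp_add]

/-! ### Integrals against densities on the half-line, and Euler's integral -/

lemma integral_withDensity_ofReal_restrict_Ioi {f : ℝ → ℝ}
    (hf : AEMeasurable f (volume.restrict (Set.Ioi 0))) (hf0 : ∀ x, 0 < x → 0 ≤ f x) (g : ℝ → ℂ) :
    ∫ x, g x ∂((volume.restrict (Set.Ioi 0)).withDensity fun x => ENNReal.ofReal (f x))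
      = ∫ x in Set.Ioi (0 : ℝ), (f x : ℂ) * g x := by
  rw [integral_withDensity_eq_integral_toReal_smul₀ hf.ennreal_ofReal (by simp)]
  refine setIntegral_congr_fun measurableSet_Ioi fun x hx => ?_
  simp [ENNReal.toReal_ofReal (hf0 x hx)]

lemma integrableOn_rpow_mul_exp_neg_mul {p r : ℝ} (hp : 0 < p) (hr : 0 < r) :
    IntegrableOn (fun x : ℝ => x ^ (p - 1) * Real.exp (-(r * x))) (Set.Ioi 0) := by
  refine Integrable.of_integral_ne_zero ?_
  rw [Real.integral_rpow_mul_exp_neg_mul_Ioi hp hr]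
  have := Real.Gamma_pos_of_pos hp
  positivity

open ProbabilityTheory Filter Topology in
/-- Euler's integral with a complex rate. Both sides are holomorphic in `s` on the right half-plane
(the left one as the complex moment generating function of `x ^ (p - 1) dx` at `-s`) and agree on
the positive half-line. -/
theorem integral_rpow_mul_cexp_neg_mul_Ioi {p : ℝ} (hp : 0 < p) {s : ℂ} (hs : 0 < s.re) :
    ∫ x in Set.Ioi (0 : ℝ), ((x ^ (p - 1) : ℝ) : ℂ) * Complex.exp (-(s * x))
      = Real.Gamma p * s ^ (-(p : ℂ)) := by
  set μ : Measure ℝ := (volume.restrict (Set.Ioi 0)).withDensity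
    fun x => ENNReal.ofReal (x ^ (p - 1)) with hμ
  have hmeas : Measurable fun x : ℝ => x ^ (p - 1) := by fun_prop
  have hnn : ∀ x : ℝ, 0 < x → 0 ≤ x ^ (p - 1) := fun x hx => by positivity
  have hmgf : ∀ z : ℂ, complexMGF id μ z
      = ∫ x in Set.Ioi (0 : ℝ), ((x ^ (p - 1) : ℝ) : ℂ) * Complex.exp (z * x) := fun z =>
    integral_withDensity_ofReal_restrict_Ioi hmeas.aemeasurable hnn _
  have hset : Set.Iio 0 ⊆ integrableExpSet id μ := by
    intro t ht
    have ht' : 0 < -t := by simpa using ht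
    change Integrable _ _
    rw [hμ, integrable_withDensity_iff_integrable_smul' (by fun_prop) (by simp)]
    refine (integrableOn_rpow_mul_exp_neg_mul hp ht').congr_fun (fun x hx => ?_) measurableSet_Ioi
    simp [ENNReal.toReal_ofReal (hnn x hx)]
  have hint : Set.Iio 0 ⊆ interior (integrableExpSet id μ) :=
    interior_maximal hset isOpen_Iio
  have hU : Convex ℝ {z : ℂ | z.re < 0} := convex_halfSpace_re_lt 0
  have han : AnalyticOnNhd ℂ (complexMGF id μ) {z : ℂ | z.re < 0} := fun z hz =>
    analyticAt_complexMGF (hint hz)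
  have han' : AnalyticOnNhd ℂ (fun z : ℂ => (Real.Gamma p : ℂ) * (-z) ^ (-(p : ℂ)))
      {z : ℂ | z.re < 0} := by
    intro z hz
    refine analyticAt_const.mul (AnalyticAt.cpow analyticAt_id.neg analyticAt_const ?_)
    exact Or.inl (by simpa using hz)
  have hreal : ∀ t : ℝ, t < 0 →
      complexMGF id μ t = Real.Gamma p * (-(t : ℂ)) ^ (-(p : ℂ)) := by
    intro t ht
    have ht' : 0 < -t := by linarith
    have h := Real.integral_rpow_mul_exp_neg_mul_Ioi hp ht'
    rw [hmgf]
    have e : ∀ x : ℝ, ((x ^ (p - 1) : ℝ) : ℂ) * Complex.exp (t * x)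
        = ((x ^ (p - 1) * Real.exp (-(-t * x)) : ℝ) : ℂ) := by intro x; push_cast; simp
    simp_rw [e]
    rw [integral_complex_ofReal, h, one_div, Real.inv_rpow ht'.le, ← Real.rpow_neg ht'.le]
    push_cast [Complex.ofReal_cpow ht'.le]
    ring
  -- Agreement on the negative reals near `-1` accumulates at `-1`.
  have hfreq : ∃ᶠ z in 𝓝[≠] (-1 : ℂ),
      complexMGF id μ z = Real.Gamma p * (-z) ^ (-(p : ℂ)) := by
    have h3 : Tendsto ((↑) : ℝ → ℂ) (𝓝[≠] (-1)) (𝓝[≠] (-1)) := by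
      rw [tendsto_nhdsWithin_iff]
      refine ⟨tendsto_nhdsWithin_of_tendsto_nhds ?_, ?_⟩
      · simpa using Complex.continuous_ofReal.tendsto (-1 : ℝ)
      · exact eventually_nhdsWithin_iff.2 (Eventually.of_forall fun t ht => by
          simpa [Complex.ext_iff] using ht)
    refine h3.frequently ?_
    refine (((eventually_lt_nhds (by norm_num : (-1 : ℝ) < 0)).filter_mono
      nhdsWithin_le_nhds).mono fun t ht => ?_).frequently
    exact hreal t ht
  have key := han.eqOn_of_preconnected_of_frequently_eq han' hU.isPreconnected
    (by simp : (-1 : ℂ) ∈ {z : ℂ | z.re < 0}) hfreq (x := -s) (by simpa using hs)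
  simp only [neg_neg] at key
  rw [← key, hmgf]
  simp

/-- The binomial series, with its coefficients written through the Gamma function. -/
theorem hasSum_Gamma_div_factorial_mul_pow {α : ℝ} (hα : 0 < α) {z : ℂ} (hz : ‖z‖ < 1) :
    HasSum (fun m : ℕ => ((Real.Gamma (α + m) / (Real.Gamma α * m.factorial) : ℝ) : ℂ) * z ^ m)
      ((1 - z) ^ (-(α : ℂ))) := by
  have h := (Complex.one_div_one_sub_cpow_hasFPowerSeriesOnBall_zero α).hasSum
    (y := z) (by simpa [Metric.eball, ← ofReal_norm] using hz)
  have hcoef : ∀ m : ℕ, Ring.choose ((α : ℂ) + m - 1) m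
      = ((Real.Gamma (α + m) / (Real.Gamma α * m.factorial) : ℝ) : ℂ) := by
    intro m
    have h1 := Ring.factorial_nsmul_multichoose_eq_ascPochhammer (α : ℂ) m
    rw [Polynomial.ascPochhammer_smeval_cast, Polynomial.ascPochhammer_smeval_eq_eval,
      ← Complex.Gamma_add_nat_div_Gamma_eq, Ring.multichoose_eq, nsmul_eq_mul] at h1
    · have hf : (m.factorial : ℂ) ≠ 0 := by exact_mod_cast m.factorial_ne_zero
      push_cast [← Complex.Gamma_ofReal]
      rw [mul_comm] at h1
      rw [eq_div_of_mul_eq hf h1, div_div]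
    · intro k hk
      have := congrArg Complex.re hk
      simp at this
      have : (0 : ℝ) ≤ k := k.cast_nonneg
      linarith
  simpa [hcoef, Complex.cpow_neg, mul_comm] using h

/-! ### The Laplace transform of the McKay density -/

/-- The coefficient of `x ^ (2 (a + 1 / 2 + m) - 1) * exp (-x c / b)` in `mcKayFun a b c x`. -/
noncomputable def mcKayCoeff (a b : ℝ) (m : ℕ) : ℝ :=
  (2 * b) ^ (-(2 * (m : ℝ) + a)) / (m.factorial * Real.Gamma (m + a + 1))

lemma mcKayCoeff_pos {a b : ℝ} (ha : -(1 / 2) < a) (hb : 0 < b) (m : ℕ) : 0 < mcKayCoeff a b m := by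
  have : 0 < Real.Gamma (m + a + 1) :=
    Real.Gamma_pos_of_pos (by linarith [(Nat.cast_nonneg m : (0 : ℝ) ≤ m)])
  unfold mcKayCoeff
  positivity

lemma mcKayFun_eq_tsum {a b c x : ℝ} (hb : 0 < b) (hx : 0 < x) :
    mcKayFun a b c x = ∑' m : ℕ, mcKayCoeff a b m *
      (x ^ (2 * (a + 1 / 2 + m) - 1) * Real.exp (-(c / b * x))) := by
  rw [mcKayFun, besselI, ← tsum_mul_left]
  refine tsum_congr fun m => ?_
  have e : x / b / 2 = (2 * b)⁻¹ * x := by field_simp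
  rw [e, Real.mul_rpow (by positivity) hx.le, Real.inv_rpow (by positivity),
    ← Real.rpow_neg (by positivity), show 2 * (a + 1 / 2 + (m : ℝ)) - 1 = a + (2 * m + a) by ring,
    Real.rpow_add hx a, mcKayCoeff, show x * c / b = c / b * x by ring]
  ring

lemma mcKayFun_nonneg {a b c x : ℝ} (ha : -(1 / 2) < a) (hb : 0 < b) (hx : 0 < x) :
    0 ≤ mcKayFun a b c x := by
  rw [mcKayFun_eq_tsum hb hx]
  refine tsum_nonneg fun m => ?_
  have := mcKayCoeff_pos ha hb m
  positivity

lemma measurable_mcKayFun (a b c : ℝ) : Measurable (mcKayFun a b c) := by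
  unfold mcKayFun besselI
  refine Measurable.mul (by fun_prop) (Measurable.tsum fun m => ?_)
  fun_prop

/-- By Legendre's duplication formula the Laplace transform of the `m`-th term of `mcKayFun` carries
the binomial coefficients of `(1 - z) ^ (-(a + 1 / 2))`. -/
lemma mcKayCoeff_mul_Gamma {a b : ℝ} (ha : -(1 / 2) < a) (hb : 0 < b) (m : ℕ) :
    mcKayCoeff a b m * Real.Gamma (2 * (a + 1 / 2 + m))
      = (2 / b) ^ a * Real.Gamma (a + 1 / 2) / √Real.pi *
        (Real.Gamma (a + 1 / 2 + m) / (Real.Gamma (a + 1 / 2) * m.factorial) * (1 / b ^ 2) ^ m) := by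
  have hm : (0 : ℝ) ≤ m := m.cast_nonneg
  have hpos1 : 0 < Real.Gamma (a + 1 / 2) := Real.Gamma_pos_of_pos (by linarith)
  have hpos2 : 0 < Real.Gamma (m + a + 1) := Real.Gamma_pos_of_pos (by linarith)
  have hdup := Real.Gamma_mul_Gamma_add_half (a + 1 / 2 + m)
  rw [show a + 1 / 2 + (m : ℝ) + 1 / 2 = m + a + 1 by ring] at hdup
  have h2 : (2 : ℝ) ^ (1 - 2 * (a + 1 / 2 + (m : ℝ)))
      = (2 * b) ^ (-(2 * (m : ℝ) + a)) / (2 / b) ^ a * b ^ (2 * m) := by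
    rw [Real.mul_rpow (by norm_num) hb.le, Real.div_rpow (by norm_num) hb.le,
      show 1 - 2 * (a + 1 / 2 + (m : ℝ)) = -(2 * (m : ℝ) + a) - a by ring,
      Real.rpow_sub (by norm_num), ← Real.rpow_natCast b (2 * m)]
    have : b ^ (-(2 * (m : ℝ) + a)) * b ^ a * b ^ ((2 * m : ℕ) : ℝ) = 1 := by
      rw [← Real.rpow_add hb, ← Real.rpow_add hb]
      push_cast
      ring_nf
      simp
    have hba : (0 : ℝ) < 2 ^ a := by positivity
    field_simp
    linear_combination -this
  rw [h2] at hdup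
  have hba : 0 < (2 / b) ^ a := by positivity
  have hpi : 0 < √Real.pi := by positivity
  have hf : (0 : ℝ) < m.factorial := by exact_mod_cast m.factorial_pos
  rw [mcKayCoeff, show (1 / b ^ 2) ^ m = 1 / b ^ (2 * m) by rw [div_pow, one_pow, ← pow_mul]]
  generalize Real.Gamma (a + 1 / 2) = g at *
  generalize Real.Gamma (a + 1 / 2 + m) = g₁ at *
  generalize Real.Gamma (2 * (a + 1 / 2 + m)) = g₂ at *
  field_simp at hdup ⊢
  linear_combination -hdup

/-- The Laplace transform of the unnormalised McKay density on the line of abscissa `c / b`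
(whose factor `exp (-x c / b)` is already part of `mcKayFun`), obtained by integrating the Bessel
series term by term and summing the resulting binomial series. -/
theorem integral_mcKayFun_mul_cexp {a b c : ℝ} (ha : -(1 / 2) < a) (hb : 0 < b) (hc : 1 < c)
    {s : ℂ} (hs : s.re = c / b) :
    ∫ x in Set.Ioi (0 : ℝ), (mcKayFun a b c x : ℂ) * Complex.exp (-((s - (c / b : ℝ)) * x))
      = ((2 / b) ^ a * Real.Gamma (a + 1 / 2) / √Real.pi : ℝ) *
        (s ^ 2 - 1 / (b : ℂ) ^ 2) ^ (-((a + 1 / 2 : ℝ) : ℂ)) := by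
  set K : ℝ := (2 / b) ^ a * Real.Gamma (a + 1 / 2) / √Real.pi with hK
  set α : ℝ := a + 1 / 2 with hα
  have hα0 : 0 < α := by rw [hα]; linarith
  have hr : 0 < c / b := by positivity
  have hs0 : 0 < s.re := hs ▸ hr
  have hsne : s ≠ 0 := fun h => by simp [h] at hs0
  have hbC : (b : ℂ) ≠ 0 := by exact_mod_cast hb.ne'
  have hp : ∀ m : ℕ, 0 < 2 * (α + m) := fun m => by positivity
  have hA : ∀ m, mcKayCoeff a b m * Real.Gamma (2 * (α + m)) = K *
      (Real.Gamma (α + m) / (Real.Gamma α * m.factorial) * (1 / b ^ 2) ^ m) :=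
    mcKayCoeff_mul_Gamma ha hb
  set F : ℕ → ℝ → ℂ := fun m x => (mcKayCoeff a b m : ℂ) *
    (((x ^ (2 * (α + m) - 1) : ℝ) : ℂ) * Complex.exp (-(s * x))) with hF
  have hnorm : ∀ m : ℕ, ∀ x : ℝ, 0 < x → ‖F m x‖ =
      mcKayCoeff a b m * (x ^ (2 * (α + m) - 1) * Real.exp (-(c / b * x))) := by
    intro m x hx
    have := mcKayCoeff_pos ha hb m
    simp only [hF, norm_mul, Complex.norm_real, Complex.norm_exp]
    rw [Real.norm_of_nonneg this.le, Real.norm_of_nonneg (by positivity)]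
    simp [hs]
  have hFint : ∀ m, Integrable (F m) (volume.restrict (Set.Ioi 0)) := by
    intro m
    refine (integrable_norm_iff (by fun_prop)).1 ?_
    exact IntegrableOn.congr_fun
      (Integrable.const_mul (integrableOn_rpow_mul_exp_neg_mul (hp m) hr) (mcKayCoeff a b m))
      (fun x hx => (hnorm m x hx).symm) measurableSet_Ioi
  -- The norms integrate to the terms of the binomial series at `1 / c ^ 2 < 1`.
  have hnormint : ∀ m : ℕ, ∫ x in Set.Ioi (0 : ℝ), ‖F m x‖ =
      K * (c / b) ^ (-(2 * α)) *
        (Real.Gamma (α + m) / (Real.Gamma α * m.factorial) * (1 / c ^ 2) ^ m) := by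
    intro m
    rw [setIntegral_congr_fun measurableSet_Ioi (fun x hx => hnorm m x hx), integral_const_mul,
      Real.integral_rpow_mul_exp_neg_mul_Ioi (hp m) hr, one_div, Real.inv_rpow hr.le,
      ← Real.rpow_neg hr.le, mul_left_comm, hA,
      show -(2 * (α + (m : ℝ))) = -(2 * α) + -((2 * m : ℕ) : ℝ) by push_cast; ring,
      Real.rpow_add hr, Real.rpow_neg hr.le ((2 * m : ℕ) : ℝ), Real.rpow_natCast, pow_mul]
    have : ((c / b) ^ 2)⁻¹ ^ m * (1 / b ^ 2) ^ m = (1 / c ^ 2) ^ m := by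
      rw [← mul_pow]; congr 1; field_simp
    rw [← this, inv_pow]
    ring
  have hFsum : Summable fun m => ∫ x in Set.Ioi (0 : ℝ), ‖F m x‖ := by
    have hz : ‖((1 / c ^ 2 : ℝ) : ℂ)‖ < 1 := by
      rw [Complex.norm_real, Real.norm_of_nonneg (by positivity), div_lt_one (by positivity)]
      exact one_lt_pow₀ hc two_ne_zero
    have h := (hasSum_Gamma_div_factorial_mul_pow hα0 hz).summable
    simp_rw [hnormint]
    refine Summable.mul_left _ (Complex.summable_ofReal.1 ?_)
    exact_mod_cast h
  have hmain := hasSum_integral_of_summable_integral_norm hFint hFsum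
  have hlhs : ∫ x in Set.Ioi (0 : ℝ), ∑' m, F m x
      = ∫ x in Set.Ioi (0 : ℝ),
        (mcKayFun a b c x : ℂ) * Complex.exp (-((s - (c / b : ℝ)) * x)) := by
    refine setIntegral_congr_fun measurableSet_Ioi fun x hx => ?_
    rw [mcKayFun_eq_tsum hb hx, Complex.ofReal_tsum, ← tsum_mul_right]
    refine tsum_congr fun m => ?_
    simp only [hF]
    push_cast
    rw [mul_assoc, mul_assoc, ← Complex.exp_add]
    congr 3
    ring
  rw [← hlhs]
  refine hmain.unique ?_
  have hu : ‖1 / (b * s)‖ < 1 := by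
    have h1 : c / b ≤ ‖s‖ := hs ▸ Complex.re_le_norm s
    rw [norm_div, norm_one, norm_mul, Complex.norm_real, Real.norm_of_nonneg hb.le,
      div_lt_one (by positivity)]
    calc 1 < c := hc
      _ = b * (c / b) := by field_simp
      _ ≤ b * ‖s‖ := by gcongr
  have hz : ‖(1 / (b * s)) ^ 2‖ < 1 := by
    rw [norm_pow]
    exact pow_lt_one₀ (norm_nonneg _) hu two_ne_zero
  have hu' := (abs_le.1 (Complex.abs_re_le_norm (1 / (b * s))))
  have hre1 : 0 < (1 - 1 / (b * s)).re := by
    rw [Complex.sub_re, Complex.one_re]; linarith [hu'.2]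
  have hre2 : 0 < (1 + 1 / (b * s)).re := by
    rw [Complex.add_re, Complex.one_re]; linarith [hu'.1]
  have hcb : 1 / b < c / b := by gcongr
  have hb1 : (1 / (b : ℂ)) = ((1 / b : ℝ) : ℂ) := by push_cast; rfl
  have hre3 : 0 < (s - 1 / b).re := by
    rw [hb1, Complex.sub_re, Complex.ofReal_re, hs]; linarith
  have hre4 : 0 < (s + 1 / b).re := by
    rw [hb1, Complex.add_re, Complex.ofReal_re, hs]; positivity
  -- All of `s`, `1 ± 1 / (b s)` and `s ± 1 / b` lie in the right half-plane, so that the branches of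
  -- the powers match.
  have hpow : (s ^ 2 - 1 / (b : ℂ) ^ 2) ^ (-(α : ℂ))
      = s ^ (-(α : ℂ)) * s ^ (-(α : ℂ)) * (1 - (1 / (b * s)) ^ 2) ^ (-(α : ℂ)) := by
    rw [show s ^ 2 - 1 / (b : ℂ) ^ 2 = (s - 1 / b) * (s + 1 / b) by ring,
      Complex.mul_cpow_of_re_pos hre3 hre4,
      show s - 1 / b = s * (1 - 1 / (b * s)) by field_simp,
      show s + 1 / b = s * (1 + 1 / (b * s)) by field_simp,
      Complex.mul_cpow_of_re_pos hs0 hre1, Complex.mul_cpow_of_re_pos hs0 hre2,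
      show 1 - (1 / (b * s)) ^ 2 = (1 - 1 / (b * s)) * (1 + 1 / (b * s)) by ring,
      Complex.mul_cpow_of_re_pos hre1 hre2]
    ring
  have hS := (hasSum_Gamma_div_factorial_mul_pow hα0 hz).mul_left
    (K * (s ^ (-(α : ℂ)) * s ^ (-(α : ℂ))))
  rw [mul_assoc, ← hpow] at hS
  convert! hS using 1
  funext m
  have hA' : (mcKayCoeff a b m : ℂ) * (Real.Gamma (2 * (α + m)) : ℂ) = K *
      (((Real.Gamma (α + m) / (Real.Gamma α * m.factorial) : ℝ) : ℂ) * (1 / (b : ℂ) ^ 2) ^ m) := by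
    exact_mod_cast congrArg Complex.ofReal (hA m)
  simp only [hF]
  rw [integral_const_mul, integral_rpow_mul_cexp_neg_mul_Ioi (hp m) hs0, ← mul_assoc, hA',
    show (-((2 * (α + m) : ℝ) : ℂ)) = -(α : ℂ) + -(α : ℂ) + -((2 * m : ℕ) : ℂ) by push_cast; ring,
    Complex.cpow_add _ _ hsne, Complex.cpow_add _ _ hsne, Complex.cpow_neg s ((2 * m : ℕ) : ℂ),
    Complex.cpow_natCast, pow_mul]
  have : (s ^ 2)⁻¹ ^ m * (1 / (b : ℂ) ^ 2) ^ m = ((1 / (b * s)) ^ 2) ^ m := by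
    rw [← mul_pow]; congr 1; field_simp
  rw [← this, inv_pow]
  ring

/-! ### The characteristic function of the McKay distribution -/

/-- The integral of the unnormalised McKay density over `(0, ∞)`. -/
noncomputable def mcKayMass (a b c : ℝ) : ℝ :=
  (2 / b) ^ a * Real.Gamma (a + 1 / 2) / √Real.pi * ((c ^ 2 - 1) / b ^ 2) ^ (-(a + 1 / 2))

lemma mcKayMass_pos {a b c : ℝ} (ha : -(1 / 2) < a) (hb : 0 < b) (hc : 1 < c) :
    0 < mcKayMass a b c := by
  have : 0 < Real.Gamma (a + 1 / 2) := Real.Gamma_pos_of_pos (by linarith)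
  have : 0 < c ^ 2 - 1 := by nlinarith
  unfold mcKayMass
  positivity

/-- The quadratic whose power `-(a + 1 / 2)` is the characteristic function of the McKay
distribution. -/
noncomputable def mcKayDet (b c t : ℝ) : ℂ :=
  ((1 - b ^ 2 / (c ^ 2 - 1) * t ^ 2 : ℝ) : ℂ) - ((2 * b * c / (c ^ 2 - 1) * t : ℝ) : ℂ) * Complex.I

@[simp] lemma mcKayDet_zero (b c : ℝ) : mcKayDet b c 0 = 1 := by simp [mcKayDet]

lemma integral_mcKayFun_mul_cexp_I {a b c : ℝ} (ha : -(1 / 2) < a) (hb : 0 < b) (hc : 1 < c)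
    (t : ℝ) :
    ∫ x in Set.Ioi (0 : ℝ), (mcKayFun a b c x : ℂ) * Complex.exp (t * x * Complex.I)
      = mcKayMass a b c * mcKayDet b c t ^ (-((a + 1 / 2 : ℝ) : ℂ)) := by
  have hc2 : 0 < c ^ 2 - 1 := by nlinarith
  have hr : 0 < (c ^ 2 - 1) / b ^ 2 := by positivity
  have hbC : (b : ℂ) ≠ 0 := by exact_mod_cast hb.ne'
  have hcC : (c : ℂ) ^ 2 - 1 ≠ 0 := by exact_mod_cast hc2.ne'
  have h := integral_mcKayFun_mul_cexp ha hb hc (s := (c / b : ℝ) - t * Complex.I) (by simp)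
  have e : ((c / b : ℝ) - t * Complex.I : ℂ) ^ 2 - 1 / (b : ℂ) ^ 2
      = (((c ^ 2 - 1) / b ^ 2 : ℝ) : ℂ) * mcKayDet b c t := by
    rw [mcKayDet]
    push_cast
    field_simp
    linear_combination ((t : ℂ) ^ 2 * b ^ 2) * Complex.I_sq
  have hne : mcKayDet b c t ≠ 0 := by
    intro h0
    have h1 := congrArg Complex.re h0
    have h2 := congrArg Complex.im h0
    simp only [mcKayDet, Complex.sub_re, Complex.sub_im, Complex.ofReal_re, Complex.ofReal_im,
      Complex.re_ofReal_mul, Complex.im_ofReal_mul, Complex.I_re, Complex.I_im, Complex.zero_re,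
      Complex.zero_im] at h1 h2
    have : t = 0 := by
      have h3 : 2 * b * c / (c ^ 2 - 1) ≠ 0 := by positivity
      simpa [h3] using h2
    simp [this] at h1
  have hpow : (((c ^ 2 - 1) / b ^ 2 : ℝ) * mcKayDet b c t : ℂ) ^ (-((a + 1 / 2 : ℝ) : ℂ))
      = (((c ^ 2 - 1) / b ^ 2) ^ (-(a + 1 / 2)) : ℝ) *
        mcKayDet b c t ^ (-((a + 1 / 2 : ℝ) : ℂ)) := by
    have hrC : (((c ^ 2 - 1) / b ^ 2 : ℝ) : ℂ) ≠ 0 := by exact_mod_cast hr.ne'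
    rw [Complex.ofReal_cpow hr.le, Complex.cpow_def_of_ne_zero (mul_ne_zero hrC hne),
      Complex.log_ofReal_mul hr hne, add_mul, Complex.exp_add, Complex.cpow_def_of_ne_zero hne,
      Complex.cpow_def_of_ne_zero hrC, Complex.ofReal_log hr.le, Complex.ofReal_neg]
  rw [e, hpow, ← mul_assoc, ← Complex.ofReal_mul] at h
  rw [mcKayMass, ← h]
  refine integral_congr_ae (Filter.Eventually.of_forall fun x => ?_)
  simp only
  congr 2
  ring

lemma integral_mcKayFun {a b c : ℝ} (ha : -(1 / 2) < a) (hb : 0 < b) (hc : 1 < c) :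
    ∫ x in Set.Ioi (0 : ℝ), mcKayFun a b c x = mcKayMass a b c := by
  have h := integral_mcKayFun_mul_cexp_I ha hb hc 0
  simp only [Complex.ofReal_zero, zero_mul, Complex.exp_zero, mul_one, mcKayDet_zero,
    Complex.one_cpow, integral_complex_ofReal] at h
  exact_mod_cast h

theorem IsMcKayTypeI.charFun_eq {a b c : ℝ} {ν : Measure ℝ} (h : IsMcKayTypeI a b c ν) (t : ℝ) :
    charFun ν t = mcKayDet b c t ^ (-((a + 1 / 2 : ℝ) : ℂ)) := by
  obtain ⟨ha, hb, hc, hprob, k, hk, hν⟩ := h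
  have key : ∀ t : ℝ, charFun ν t
      = k * mcKayMass a b c * mcKayDet b c t ^ (-((a + 1 / 2 : ℝ) : ℂ)) := by
    intro t
    rw [charFun_apply_real, hν, integral_withDensity_ofReal_restrict_Ioi
      ((measurable_mcKayFun a b c).const_mul k).aemeasurable
      (fun x hx => mul_nonneg hk.le (mcKayFun_nonneg ha hb hx)), mul_assoc,
      ← integral_mcKayFun_mul_cexp_I ha hb hc, ← integral_const_mul]
    push_cast
    simp_rw [mul_assoc]
  have h0 := key 0
  simp only [charFun_zero, probReal_univ, mcKayDet_zero, Complex.one_cpow, mul_one,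
    Complex.ofReal_one] at h0
  rw [key, ← h0, one_mul]

/-- The total mass of `mcKayFun` is finite and positive, so it can be normalised. -/
theorem exists_isMcKayTypeI {a b c : ℝ} (ha : -(1 / 2) < a) (hb : 0 < b) (hc : 1 < c) :
    ∃ ν : Measure ℝ, IsMcKayTypeI a b c ν := by
  have hM := mcKayMass_pos ha hb hc
  have hk : 0 < (mcKayMass a b c)⁻¹ := inv_pos.2 hM
  refine ⟨_, ha, hb, hc, ⟨?_⟩, _, hk, rfl⟩
  have hint : Integrable (mcKayFun a b c) (volume.restrict (Set.Ioi 0)) :=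
    .of_integral_ne_zero (by rw [integral_mcKayFun ha hb hc]; exact hM.ne')
  rw [withDensity_apply _ MeasurableSet.univ, Measure.restrict_univ,
    ← ofReal_integral_eq_lintegral_ofReal (hint.const_mul _), integral_const_mul,
    integral_mcKayFun ha hb hc, inv_mul_cancel₀ hM.ne', ENNReal.ofReal_one]
  filter_upwards [ae_restrict_mem measurableSet_Ioi] with x hx
  exact mul_nonneg hk.le (mcKayFun_nonneg ha hb hx)

/-! ### The sum of the components of a bivariate gamma vector -/

lemma gammaDet_eq (c₁ c₂ c₁₂ : ℝ) (t : EuclideanSpace ℝ (Fin 2)) :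
    gammaDet !![c₁, c₁₂; c₁₂, c₂] t = ((1 - (c₁ * c₂ - c₁₂ ^ 2) * (t 0 * t 1) : ℝ) : ℂ)
      - ((c₁ * t 0 + c₂ * t 1 : ℝ) : ℂ) * Complex.I := by
  simp only [gammaDet, Matrix.det_fin_two, Matrix.sub_apply, Matrix.smul_apply,
    Matrix.mul_diagonal, Matrix.map_apply, smul_eq_mul]
  simp
  linear_combination ((c₁ : ℂ) * c₂ - c₁₂ ^ 2) * t 0 * t 1 * Complex.I_sq

/-- A law on the line is determined by its characteristic function on `[0, ∞)`, since a
characteristic function takes conjugate values at `t` and `-t`. -/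
lemma MeasureTheory.Measure.ext_of_charFun_nonneg {μ ν : Measure ℝ}
    [IsFiniteMeasure μ] [IsFiniteMeasure ν]
    (h : ∀ t, 0 ≤ t → charFun μ t = charFun ν t) : μ = ν := by
  refine Measure.ext_of_charFun (funext fun t => ?_)
  rcases le_total 0 t with ht | ht
  · exact h t ht
  · rw [← neg_neg t, charFun_neg, charFun_neg (-t), h _ (neg_nonneg.2 ht)]

lemma charFun_map_sum_coords (μ : Measure (EuclideanSpace ℝ (Fin 2))) (t : ℝ) :
    charFun (μ.map fun x => x 0 + x 1) t = charFun μ !₂[t, t] := by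
  rw [charFun_apply_real, charFun_apply, integral_map (by fun_prop) (by fun_prop)]
  refine integral_congr_ae (Filter.Eventually.of_forall fun x => ?_)
  simp [PiLp.inner_apply, Fin.sum_univ_two]
  ring_nf

lemma IsBivariateGamma.entries_pos {α c₁ c₂ c₁₂ : ℝ} {μ : Measure (EuclideanSpace ℝ (Fin 2))}
    (h : IsBivariateGamma α !![c₁, c₁₂; c₁₂, c₂] μ) :
    0 < c₁ ∧ 0 < c₂ ∧ 0 < c₁ * c₂ - c₁₂ ^ 2 := by
  have hd := h.posDef.det_pos
  rw [Matrix.det_fin_two] at hd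
  exact ⟨by simpa using h.posDef.diag_pos (i := 0), by simpa using h.posDef.diag_pos (i := 1),
    by simpa [sq] using hd⟩

/-- With the parameters of the matrix, `b ^ 2 / (c ^ 2 - 1)` is its determinant and
`2 b c / (c ^ 2 - 1)` its trace. -/
lemma mcKayDet_mcKayB_mcKayC {c₁ c₂ c₁₂ : ℝ} (hD : 0 < c₁ * c₂ - c₁₂ ^ 2)
    (hR : 0 < (c₁ + c₂) ^ 2 - 4 * (c₁ * c₂ - c₁₂ ^ 2)) (t : ℝ) :
    mcKayDet (mcKayB c₁ c₂ c₁₂) (mcKayC c₁ c₂ c₁₂) t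
      = gammaDet !![c₁, c₁₂; c₁₂, c₂] !₂[t, t] := by
  have hR' := Real.sqrt_pos.2 hR
  have hsq := Real.sq_sqrt hR.le
  rw [gammaDet_eq, mcKayDet]
  set R := √((c₁ + c₂) ^ 2 - 4 * (c₁ * c₂ - c₁₂ ^ 2)) with hRdef
  set D := c₁ * c₂ - c₁₂ ^ 2 with hDdef
  have hc : mcKayC c₁ c₂ c₁₂ ^ 2 - 1 = 4 * D / R ^ 2 := by
    rw [mcKayC, ← hDdef, ← hRdef, div_pow]
    field_simp
    linarith
  have h1 : mcKayB c₁ c₂ c₁₂ ^ 2 / (mcKayC c₁ c₂ c₁₂ ^ 2 - 1) = D := by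
    rw [hc, mcKayB, ← hDdef, ← hRdef]
    field_simp
    norm_num
  have h2 : 2 * mcKayB c₁ c₂ c₁₂ * mcKayC c₁ c₂ c₁₂ / (mcKayC c₁ c₂ c₁₂ ^ 2 - 1) = c₁ + c₂ := by
    rw [hc, mcKayB, mcKayC, ← hDdef, ← hRdef]
    field_simp
    ring
  rw [h1, h2]
  simp
  ring

/-- A McKay law with the parameters of a bivariate gamma law is the law of the sum of the
components: on `[0, ∞)` the characteristic functions coincide. -/
theorem IsMcKayTypeI.eq_map_of_isBivariateGamma {α c₁ c₂ c₁₂ : ℝ} {ν : Measure ℝ}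
    {μ : Measure (EuclideanSpace ℝ (Fin 2))}
    (hν : IsMcKayTypeI (α - 1 / 2) (mcKayB c₁ c₂ c₁₂) (mcKayC c₁ c₂ c₁₂) ν)
    (hμ : IsBivariateGamma α !![c₁, c₁₂; c₁₂, c₂] μ) :
    ν = μ.map fun x => x 0 + x 1 := by
  have := hν.isProbabilityMeasure
  have := hμ.isProbabilityMeasure
  obtain ⟨h1, h2, hD⟩ := hμ.entries_pos
  -- `b > 0` excludes the multiples of the identity: there the square root vanishes, and `mcKayB` is
  -- `0` by the convention for division by zero.
  have hR : 0 < (c₁ + c₂) ^ 2 - 4 * (c₁ * c₂ - c₁₂ ^ 2) := by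
    by_contra hR
    have hb := hν.b_pos
    simp [mcKayB, Real.sqrt_eq_zero_of_nonpos (not_lt.1 hR)] at hb
  refine Measure.ext_of_charFun_nonneg fun t ht => ?_
  rw [hν.charFun_eq, charFun_map_sum_coords,
    hμ.charFun_eq _ (by simpa [Fin.forall_fin_two] using ht),
    mcKayDet_mcKayB_mcKayC hD hR]
  congr 2
  push_cast
  ring

/-! ### Existence of bivariate gamma vectors -/

open ProbabilityTheory in
theorem charFun_gammaMeasure {p r : ℝ} (hp : 0 < p) (hr : 0 < r) (t : ℝ) :
    charFun (gammaMeasure p r) t = (1 - (t / r : ℝ) * Complex.I) ^ (-(p : ℂ)) := by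
  have hG := Real.Gamma_pos_of_pos hp
  have hsupp : ∀ x ∉ Set.Ici (0 : ℝ),
      (gammaPDF p r x).toReal • Complex.exp (t * x * Complex.I) = 0 := by
    intro x hx
    simp [gammaPDF_of_neg (not_le.1 hx)]
  have hmeas : Measurable (gammaPDF p r) := (measurable_gammaPDFReal p r).ennreal_ofReal
  rw [charFun_apply_real, gammaMeasure, integral_withDensity_eq_integral_toReal_smul hmeas
    (by simp [gammaPDF]), ← setIntegral_eq_integral_of_forall_compl_eq_zero hsupp,
    integral_Ici_eq_integral_Ioi]
  have hre : 0 < (1 - (t / r : ℝ) * Complex.I).re := by simp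
  have hrre : 0 < (r * (1 - (t / r : ℝ) * Complex.I)).re := by simpa using hr
  have h := integral_rpow_mul_cexp_neg_mul_Ioi hp hrre
  rw [Complex.mul_cpow_of_re_pos (by simpa using hr) hre] at h
  have hrp : ((r ^ p : ℝ) : ℂ) * (r : ℂ) ^ (-(p : ℂ)) = 1 := by
    rw [Complex.ofReal_cpow hr.le, ← Complex.cpow_add _ _ (by exact_mod_cast hr.ne')]
    simp
  have hGC : (Real.Gamma p : ℂ) ≠ 0 := by exact_mod_cast hG.ne'
  have hrC : (r : ℂ) ≠ 0 := by exact_mod_cast hr.ne'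
  calc _ = ∫ x in Set.Ioi (0 : ℝ), ((r ^ p / Real.Gamma p : ℝ) : ℂ) * (((x ^ (p - 1) : ℝ) : ℂ) *
        Complex.exp (-(r * (1 - (t / r : ℝ) * Complex.I) * x))) := by
        refine setIntegral_congr_fun measurableSet_Ioi fun x hx => ?_
        rw [gammaPDF, ENNReal.toReal_ofReal (gammaPDFReal_nonneg hp hr x), gammaPDFReal,
          if_pos (le_of_lt hx), Complex.real_smul]
        push_cast
        rw [mul_assoc, mul_assoc, ← Complex.exp_add]
        congr 3
        field_simp
        ring
    _ = _ := by
        rw [integral_const_mul, h]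
        generalize (1 - ((t / r : ℝ) : ℂ) * Complex.I) ^ (-(p : ℂ)) = w
        rw [Complex.ofReal_div]
        field_simp
        linear_combination w * hrp

open ProbabilityTheory in
/-- For a diagonal covariance matrix the components are independent gamma variables. -/
theorem exists_isBivariateGamma_diagonal {α c₁ c₂ : ℝ} (hα : 0 < α) (h₁ : 0 < c₁) (h₂ : 0 < c₂) :
    ∃ μ, IsBivariateGamma α !![c₁, 0; 0, c₂] μ := by
  have := isProbabilityMeasure_gammaMeasure hα (inv_pos.2 h₁)
  have := isProbabilityMeasure_gammaMeasure hα (inv_pos.2 h₂)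
  have hi : ∀ i : Fin 2, IsProbabilityMeasure (gammaMeasure α (![c₁⁻¹, c₂⁻¹] i)) := by
    intro i; fin_cases i <;> assumption
  refine ⟨(Measure.pi fun i : Fin 2 => gammaMeasure α (![c₁⁻¹, c₂⁻¹] i)).map (WithLp.toLp 2),
    hα, ?_, Measure.isProbabilityMeasure_map (by fun_prop), fun t _ => ?_⟩
  · have e : !![c₁, 0; 0, c₂] = Matrix.diagonal ![c₁, c₂] := by
      ext i j; fin_cases i <;> fin_cases j <;> simp
    rw [e, Matrix.posDef_diagonal_iff]
    intro i; fin_cases i <;> simpa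
  · rw [charFun_pi, Fin.prod_univ_two]
    simp only [Matrix.cons_val_zero, Matrix.cons_val_one]
    rw [charFun_gammaMeasure hα (inv_pos.2 h₁), charFun_gammaMeasure hα (inv_pos.2 h₂),
      ← Complex.mul_cpow_of_re_pos (by simp) (by simp), gammaDet_eq]
    congr 1
    push_cast
    field_simp
    linear_combination (c₁ : ℂ) * c₂ * t 0 * t 1 * Complex.I_sq

/-! ### McKay type I laws and sums of bivariate gamma components -/

theorem mainTheorem7 {Ω : Type*} [MeasurableSpace Ω] (P : Measure Ω) [IsProbabilityMeasure P] :
    -- the sum of the components of a bivariate gamma vector is McKay type I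
    (∀ (α c₁ c₂ c₁₂ : ℝ) (G₁ G₂ : Ω → ℝ), AEMeasurable G₁ P → AEMeasurable G₂ P →
      IsBivariateGamma α !![c₁, c₁₂; c₁₂, c₂] (P.map (fun ω => !₂[G₁ ω, G₂ ω])) →
      (c₁ ≠ c₂ ∨ c₁₂ ≠ 0) →
      IsMcKayTypeI (α - 1 / 2) (mcKayB c₁ c₂ c₁₂) (mcKayC c₁ c₂ c₁₂)
        (P.map (fun ω => G₁ ω + G₂ ω))) ∧
    -- every McKay type I variable is represented in this way
    (∀ (a b c : ℝ) (F : Ω → ℝ), AEMeasurable F P → IsMcKayTypeI a b c (P.map F) →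
      (∀ (α c₁ c₂ c₁₂ : ℝ) (μ : Measure (EuclideanSpace ℝ (Fin 2))),
        IsBivariateGamma α !![c₁, c₁₂; c₁₂, c₂] μ →
        a = α - 1 / 2 → b = mcKayB c₁ c₂ c₁₂ → c = mcKayC c₁ c₂ c₁₂ →
        P.map F = μ.map (fun x => x 0 + x 1)) ∧
      ∃ (α c₁ c₂ c₁₂ : ℝ) (μ : Measure (EuclideanSpace ℝ (Fin 2))),
        IsBivariateGamma α !![c₁, c₁₂; c₁₂, c₂] μ ∧
        a = α - 1 / 2 ∧ b = mcKayB c₁ c₂ c₁₂ ∧ c = mcKayC c₁ c₂ c₁₂ ∧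
        P.map F = μ.map (fun x => x 0 + x 1)) := by
  refine ⟨fun α c₁ c₂ c₁₂ G₁ G₂ hG₁ hG₂ hG hC => ?_, fun a b c F _ hF => ⟨?_, ?_⟩⟩
  · obtain ⟨h1, h2, hD⟩ := hG.entries_pos
    have hR : 0 < (c₁ + c₂) ^ 2 - 4 * (c₁ * c₂ - c₁₂ ^ 2) := by
      rw [show (c₁ + c₂) ^ 2 - 4 * (c₁ * c₂ - c₁₂ ^ 2) = (c₁ - c₂) ^ 2 + 4 * c₁₂ ^ 2 by ring]
      rcases hC with h | h
      · have := sub_ne_zero.2 h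
        positivity
      · positivity
    have hR' := Real.sqrt_pos.2 hR
    obtain ⟨ν, hν⟩ := exists_isMcKayTypeI (a := α - 1 / 2) (b := mcKayB c₁ c₂ c₁₂)
      (c := mcKayC c₁ c₂ c₁₂) (by linarith [hG.α_pos]) (by unfold mcKayB; positivity)
      (by
        rw [mcKayC, one_lt_div hR', Real.sqrt_lt' (by positivity)]
        linarith)
    have hmap : P.map (fun ω => G₁ ω + G₂ ω)
        = (P.map fun ω => !₂[G₁ ω, G₂ ω]).map fun x => x 0 + x 1 := by
      have hG' : AEMeasurable (fun ω => !₂[G₁ ω, G₂ ω]) P := by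
        refine (WithLp.measurable_toLp 2 _).comp_aemeasurable (aemeasurable_pi_lambda _ fun i => ?_)
        fin_cases i <;> simpa
      rw [AEMeasurable.map_map_of_aemeasurable (by fun_prop) hG']
      simp [Function.comp_def]
    rw [hmap, ← hν.eq_map_of_isBivariateGamma hG]
    exact hν
  · rintro α c₁ c₂ c₁₂ μ hμ rfl rfl rfl
    exact hF.eq_map_of_isBivariateGamma hμ
  · have hb := hF.b_pos
    have hc := hF.one_lt
    have hc1 : 0 < c - 1 := by linarith
    have hc2 : 0 < c + 1 := by linarith
    -- `b / (c - 1)` and `b / (c + 1)` are the eigenvalues of every matrix with parameters `b, c`.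
    obtain ⟨μ, hμ⟩ := exists_isBivariateGamma_diagonal (α := a + 1 / 2) (c₁ := b / (c - 1))
      (c₂ := b / (c + 1)) (by linarith [hF.neg_half_lt]) (by positivity) (by positivity)
    have hR : √((b / (c - 1) + b / (c + 1)) ^ 2
        - 4 * (b / (c - 1) * (b / (c + 1)) - 0 ^ 2)) = b / (c - 1) - b / (c + 1) := by
      rw [show (b / (c - 1) + b / (c + 1)) ^ 2 - 4 * (b / (c - 1) * (b / (c + 1)) - 0 ^ 2)
        = (b / (c - 1) - b / (c + 1)) ^ 2 by ring]
      refine Real.sqrt_sq (sub_nonneg.2 ?_)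
      gcongr
      linarith
    have hR2 : b / (c - 1) - b / (c + 1) = 2 * b / ((c - 1) * (c + 1)) := by field_simp; ring
    have ha' : a = a + 1 / 2 - 1 / 2 := by ring
    have hb' : b = mcKayB (b / (c - 1)) (b / (c + 1)) 0 := by
      rw [mcKayB, hR, hR2]
      field_simp
      ring
    have hc' : c = mcKayC (b / (c - 1)) (b / (c + 1)) 0 := by
      rw [mcKayC, hR, hR2]
      field_simp
      ring
    refine ⟨_, _, _, _, μ, hμ, ha', hb', hc', ?_⟩
    refine IsMcKayTypeI.eq_map_of_isBivariateGamma ?_ hμ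
    rwa [← ha', ← hb', ← hc']
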